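/- Let $k \ge 3$ and let $H=(V,E)$ be a finite $k$-uniform hypergraph of order $n=|V|\ge 1$ and size $m=|E|$, where $E$ is a multiset of $k$-subsets of $V$ (parallel edges are allowed). A walk in $H$ is a sequence $v_0e_1v_1\ldots e_sv_s$ of vertices $v_i$ (its anchors) and edges $e_i$ with $v_{i-1},v_i\in e_i$ and $v_{i-1}\ne v_i$ for all $i$; it is a closed trail if $s\ge 2$, $v_0=v_s$ and $e_1,\ldots,e_s$ are pairwise distinct. Write $c(\cdot)$ for the number of connected components of a hypergraph or graph; an edge $e$ of $H$ is a cut edge if $c(H\setminus e)>c(H)$, where $H\setminus e$ keeps all the vertices. Let $G$ be the incidence graph of $H$, that is, the bipartite graph on $V\cup E$ in which $v\in V$ and $e\in E$ are adjacent if and only if $v\in e$, and let $G^*$ be the graph obtained from $G$ by appending $2(m+n)^2$ loops at every vertex $v \in V$. Assume that $H$ has no cut edges and that for every $X\subseteq E$ with $|X|\ge 2$, $$|X|\ \ge\ 2\left\lfloor\frac{c(G^*-X)+3}{k}\right\rfloor .$$ Then $H$ is quasi-eulerian: either $H$ has no edges, or $H$ admits an Euler family, that is, a collection of pairwise anchor-disjoint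 and edge-disjoint closed trails that jointly traverse every edge of $H$. -/

import Mathlib

/-- A hypergraph with vertex set `V` whose multiset of edges is given as the family
`edge : E → Finset V`; distinct indices are distinct edges, even if they have the same vertices. -/
structure MultiHypergraph (V E : Type*) where
  /-- The set of vertices of an edge. -/
  edge : E → Finset V

namespace MultiHypergraph

/-- The order of a hypergraph: its number of vertices. -/
def order {V E : Type*} [Fintype V] (_H : MultiHypergraph V E) : ℕ := Fintype.card V

/-- The size of a hypergraph: its number of edges, counted with multiplicity. -/
def size {V E : Type*} [Fintype E] (_H : MultiHypergraph V E) : ℕ := Fintype.card E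

/-- A hypergraph is `k`-uniform if every edge has cardinality `k`. -/
def IsUniform {V E : Type*} (H : MultiHypergraph V E) (k : ℕ) : Prop :=
  ∀ e, (H.edge e).card = k

/-- A `(u, w)`-walk `u e₁ v₁ e₂ … eₗ w`: consecutive anchors are distinct and both lie in
the edge between them. -/
inductive Walk {V E : Type*} (H : MultiHypergraph V E) : V → V → Type _
  | nil (u : V) : Walk H u u
  | cons {u v w : V} (e : E) (hu : u ∈ H.edge e) (hv : v ∈ H.edge e) (huv : u ≠ v)
      (p : Walk H v w) : Walk H u w

namespace Walk

/-- The sequence of anchors of a walk. -/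
def anchors {V E : Type*} {H : MultiHypergraph V E} {u w : V} : H.Walk u w → List V
  | nil u => [u]
  | cons (u := u) _ _ _ _ p => u :: p.anchors

/-- The sequence of edges of a walk. -/
def edges {V E : Type*} {H : MultiHypergraph V E} {u w : V} : H.Walk u w → List E
  | nil _ => []
  | cons e _ _ _ p => e :: p.edges

end Walk

/-- The number of connected components, that is, of classes of vertices that are pairwise
connected by walks. -/
noncomputable def numComponents {V E : Type*} (H : MultiHypergraph V E) : ℕ :=
  {C : Set V | ∃ u, C = {v | Nonempty (H.Walk u v)}}.ncard

/-- The hypergraph obtained by removing one edge and keeping all vertices. -/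
def deleteEdge {V E : Type*} (H : MultiHypergraph V E) (e : E) :
    MultiHypergraph V {e' : E // e' ≠ e} where
  edge e' := H.edge e'

/-- An edge is a cut edge if its removal increases the number of connected components. -/
def IsCutEdge {V E : Type*} (H : MultiHypergraph V E) (e : E) : Prop :=
  H.numComponents < (H.deleteEdge e).numComponents

/-- A closed trail: a walk with at least two edges that returns to its first anchor and does not
repeat an edge. -/
structure ClosedTrail {V E : Type*} (H : MultiHypergraph V E) where
  /-- The first and last anchor. -/
  base : V
  /-- The underlying walk. -/
  walk : H.Walk base base
  two_le_length : 2 ≤ walk.edges.length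
  edges_nodup : walk.edges.Nodup

/-- An Euler family: a collection of pairwise anchor-disjoint and edge-disjoint closed trails that
jointly traverse every edge. -/
def IsEulerFamily {V E : Type*} (H : MultiHypergraph V E) (F : Set H.ClosedTrail) : Prop :=
  (F.Pairwise fun S T =>
      S.walk.anchors.Disjoint T.walk.anchors ∧ S.walk.edges.Disjoint T.walk.edges) ∧
    ∀ e : E, ∃ T ∈ F, e ∈ T.walk.edges

/-- A hypergraph is quasi-eulerian if it has no edges or admits an Euler family. -/
def IsQuasiEulerian {V E : Type*} (H : MultiHypergraph V E) : Prop :=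
  IsEmpty E ∨ ∃ F : Set H.ClosedTrail, H.IsEulerFamily F

/-- The incidence graph: the bipartite simple graph on `V ∪ E` in which `v` and `e` are adjacent
if and only if `v ∈ e`. -/
def incidenceGraph {V E : Type*} (H : MultiHypergraph V E) : SimpleGraph (V ⊕ E) where
  Adj
    | .inl v, .inr e => v ∈ H.edge e
    | .inr e, .inl v => v ∈ H.edge e
    | _, _ => False
  symm := ⟨by rintro (v | e) (v' | e') h <;> exact h⟩
  loopless := ⟨by rintro (v | e) h <;> exact h⟩

/-- The multigraph obtained from the incidence graph by appending `r` loops at every vertex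
of `H`. Its edges are the edges of the incidence graph together with the loops `(v, i)`. -/
def loopedIncidenceGraph {V E : Type*} (H : MultiHypergraph V E) (r : ℕ) :
    Graph (V ⊕ E) (Sym2 (V ⊕ E) ⊕ V × Fin r) where
  vertexSet := Set.univ
  IsLink
    | .inl s, x, y => H.incidenceGraph.Adj x y ∧ s = s(x, y)
    | .inr (v, _), x, y => x = .inl v ∧ y = .inl v
  isLink_symm := by
    rintro (s | ⟨v, i⟩) -
    · exact ⟨fun x y h => ⟨h.1.symm, h.2.trans Sym2.eq_swap⟩⟩
    · exact ⟨fun x y h => ⟨h.2, h.1⟩⟩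
  eq_or_eq_of_isLink_of_isLink := by
    rintro (s | ⟨v, i⟩) x y z w h h'
    · have h2 := h.2.symm.trans h'.2
      rw [Sym2.eq_iff] at h2
      exact h2.imp And.left And.left
    · exact Or.inl (h.1.trans h'.1.symm)
  left_mem_of_isLink := fun _ _ _ _ => Set.mem_univ _

end MultiHypergraph

/-- The number of connected components of a multigraph. -/
noncomputable def Graph.numComponents {α β : Type*} (G : Graph α β) : ℕ :=
  {C : Set α | ∃ x ∈ G.vertexSet, C = {y | Relation.ReflTransGen G.Adj x y}}.ncard

/-! Choosing two distinct vertices in every edge of H gives a multigraph on V. If all its degrees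
are even, it splits into closed trails, and merging trails with a common anchor yields an Euler
family (`isQuasiEulerian_of_sum_single`). A perfect matching of `matchingGadget` provides such a
choice: the twins (e, i) are matched to incidences of e, and the clique of v, of even order 2m,
pairs off its other vertices, so v is chosen an even number of times.

If there is no perfect matching, a Tutte set of least cardinality has the form `barrier S T` with S
and T disjoint (`exists_barrier`). Let s = |S|, t = |T|, and let q be the number of odd components
containing vertices of H. The barrier has at least 2s + kt vertices and leaves at most q + 2t odd
components, so q + 2t ≤ 2s + kt is a contradiction.

Three bounds on q give this inequality. By parity each of the q components meets an odd number of
T-incidences, so q ≤ kt. Without cut edges, a single T-incidence with no S-incidence is impossible,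
so 3q ≤ kt + 2ks. Finally q ≤ c(G* - (S ∪ T)), the loops being irrelevant to connectivity, and the
hypothesis applies with X = S ∪ T. -/

namespace SimpleGraph

/-! ### Tutte's theorem with a minimal violating set -/

/-- The graph on the same vertices that keeps only the edges avoiding the set `u`. -/
def avoiding {α : Type*} (G : SimpleGraph α) (u : Set α) : SimpleGraph α where
  Adj a b := G.Adj a b ∧ a ∉ u ∧ b ∉ u
  symm := ⟨fun _ _ h => ⟨h.1.symm, h.2.2, h.2.1⟩⟩
  loopless := ⟨fun _ h => h.1.ne rfl⟩

/-- The vertex sets of the odd components that remain after deleting `u`. -/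
def oddParts {α : Type*} (G : SimpleGraph α) (u : Set α) : Set (Set α) :=
  {K | ∃ x ∉ u, K = {y | (G.avoiding u).Reachable x y} ∧ Odd K.ncard}

lemma Reachable.notMem_of_avoiding {α : Type*} {G : SimpleGraph α} {u : Set α} {x y : α}
    (h : (G.avoiding u).Reachable x y) (hx : x ∉ u) : y ∉ u := by
  obtain ⟨p⟩ := h
  induction p with
  | nil => exact hx
  | cons h _ ih => exact ih h.2.2

lemma reachable_deleteVerts_iff {α : Type*} (G : SimpleGraph α) (u : Set α)
    (x y : ((⊤ : G.Subgraph).deleteVerts u).verts) :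
    ((⊤ : G.Subgraph).deleteVerts u).coe.Reachable x y ↔
      (G.avoiding u).Reachable x.1 y.1 := by
  constructor
  · intro h
    let f : ((⊤ : G.Subgraph).deleteVerts u).coe →g G.avoiding u :=
      ⟨Subtype.val, fun {a b} h => by
        have h' : ((⊤ : G.Subgraph).deleteVerts u).Adj a.1 b.1 := h
        rw [Subgraph.deleteVerts_adj] at h'
        exact ⟨h'.2.2.2.2, h'.2.1, h'.2.2.2.1⟩⟩
    exact h.map f
  · rintro ⟨p⟩
    obtain ⟨x, hx⟩ := x
    obtain ⟨y, hy⟩ := y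
    simp only at p
    induction p with
    | nil => exact Reachable.refl _
    | cons h p ih =>
      have hv : _ ∈ ((⊤ : G.Subgraph).deleteVerts u).verts := ⟨Set.mem_univ _, h.2.2⟩
      refine Reachable.trans (Adj.reachable ?_) (ih hv hy)
      change ((⊤ : G.Subgraph).deleteVerts u).Adj _ _
      rw [Subgraph.deleteVerts_adj]
      exact ⟨trivial, h.2.1, trivial, h.2.2, h.1⟩

lemma ncard_oddParts {α : Type*} (G : SimpleGraph α) (u : Set α) :
    (G.oddParts u).ncard = ((⊤ : G.Subgraph).deleteVerts u).coe.oddComponents.ncard := by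
  have himage (x : ((⊤ : G.Subgraph).deleteVerts u).verts) :
      Subtype.val '' (((⊤ : G.Subgraph).deleteVerts u).coe.connectedComponentMk x).supp =
        {y | (G.avoiding u).Reachable x.1 y} := by
    ext y
    simp only [Set.mem_image, ConnectedComponent.mem_supp_iff, ConnectedComponent.eq,
      Set.mem_ofPred_eq]
    constructor
    · rintro ⟨z, hz, rfl⟩
      exact (reachable_deleteVerts_iff G u x z).1 hz.symm
    · intro h
      exact ⟨⟨y, trivial, h.notMem_of_avoiding x.2.2⟩,
        ((reachable_deleteVerts_iff G u x _).2 h).symm, rfl⟩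
  have h : G.oddParts u = (fun c : ((⊤ : G.Subgraph).deleteVerts u).coe.ConnectedComponent =>
      Subtype.val '' c.supp) '' ((⊤ : G.Subgraph).deleteVerts u).coe.oddComponents := by
    ext K
    constructor
    · rintro ⟨x, hx, rfl, hodd⟩
      refine ⟨connectedComponentMk _ ⟨x, trivial, hx⟩, ?_, himage _⟩
      rw [← himage ⟨x, trivial, hx⟩, Set.ncard_image_of_injective _ Subtype.val_injective] at hodd
      exact hodd
    · rintro ⟨c, hc, rfl⟩
      induction c using ConnectedComponent.ind with
      | h x =>
        refine ⟨x.1, x.2.2, himage x, ?_⟩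
        rw [Set.ncard_image_of_injective _ Subtype.val_injective]
        exact hc
  rw [h, Set.ncard_image_of_injective]
  exact fun c d hcd => ConnectedComponent.supp_injective
    (Set.image_injective.2 Subtype.val_injective hcd)

lemma odd_ncard_oddParts_iff {α : Type*} [Finite α] (G : SimpleGraph α) (u : Set α) :
    Odd (G.oddParts u).ncard ↔ Odd uᶜ.ncard := by
  rw [ncard_oddParts, odd_ncard_oddComponents, Nat.card_coe_set_eq, Subgraph.deleteVerts_verts,
    Subgraph.verts_top, Set.compl_eq_univ_sdiff]

/-- Restoring `x` to the graph cannot enlarge a component that contains no neighbour of `x`. -/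
lemma reachable_avoiding_sdiff_singleton {α : Type*} {G : SimpleGraph α} {u : Set α} {x y : α}
    (hy : ∀ z, (G.avoiding u).Reachable y z → ¬ G.Adj x z) (hyu : y ∉ u) (z : α) :
    (G.avoiding (u \ {x})).Reachable y z ↔ (G.avoiding u).Reachable y z := by
  constructor
  · rintro ⟨p⟩
    induction p with
    | nil => exact Reachable.refl _
    | cons h p ih =>
      rename_i a b c
      have hbx : b ≠ x := by
        rintro rfl
        exact hy a (Reachable.refl _) h.1.symm
      have hb : b ∉ u := fun hb => h.2.2 ⟨hb, hbx⟩
      have hab : (G.avoiding u).Reachable a b := Adj.reachable ⟨h.1, hyu, hb⟩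
      exact hab.trans (ih (fun z hz => hy z (hab.trans hz)) hb)
  · refine fun h => h.mono (fun a b (h : (G.avoiding u).Adj a b) => ?_)
    exact ⟨h.1, fun h' => h.2.1 h'.1, fun h' => h.2.2 h'.1⟩

/-- A refinement of Tutte's theorem: in a graph without perfect matchings there is a violating set
each of whose vertices has neighbours in three different components of the rest. -/
theorem exists_oddParts_of_forall_not_isPerfectMatching {α : Type*} [Finite α]
    (G : SimpleGraph α) (h : ∀ M : G.Subgraph, ¬ M.IsPerfectMatching) :
    ∃ u : Set α, u.ncard < (G.oddParts u).ncard ∧ ∀ x ∈ u, ∃ y : Fin 3 → α,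
      (∀ i, G.Adj x (y i) ∧ y i ∉ u) ∧
      ∀ i j, (G.avoiding u).Reachable (y i) (y j) → i = j := by
  have hex : ∃ u : Set α, u.ncard < (G.oddParts u).ncard := by
    by_contra! hcon
    obtain ⟨M, hM⟩ := tutte.2 fun u hu => by
      have := hcon u
      rw [ncard_oddParts] at this
      exact absurd hu this.not_gt
    exact h M hM
  -- Least cardinality makes `u \ {x}` non-violating for every `x ∈ u`.
  obtain ⟨u, hu, hmin⟩ :=
    (Set.toFinite {u : Set α | u.ncard < (G.oddParts u).ncard}).exists_minimalFor
      (fun u => u.ncard) _ hex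
  refine ⟨u, hu, fun x hx => ?_⟩
  have hcard : (u \ {x}).ncard + 1 = u.ncard := Set.ncard_sdiff_singleton_add_one hx
  have hnot : (G.oddParts (u \ {x})).ncard ≤ (u \ {x}).ncard := by
    by_contra! hlt
    have := hmin (j := u \ {x}) hlt (by simp only; omega)
    simp only at this
    omega
  have hpar : Odd (G.oddParts (u \ {x})).ncard ↔ ¬ Odd (G.oddParts u).ncard := by
    rw [odd_ncard_oddParts_iff, odd_ncard_oddParts_iff]
    have h1 := Set.ncard_add_ncard_compl u
    have h2 := Set.ncard_add_ncard_compl (u \ {x})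
    grind
  let A : Set (Set α) := {K ∈ G.oddParts u | ∃ y ∈ K, G.Adj x y}
  have hsub : G.oddParts u \ A ⊆ G.oddParts (u \ {x}) := by
    rintro K ⟨⟨y, hy, rfl, hodd⟩, hA⟩
    refine ⟨y, fun hyu => hy hyu.1, ?_, hodd⟩
    ext z
    refine (reachable_avoiding_sdiff_singleton (fun z hz hxz => hA ?_) hy z).symm
    exact ⟨⟨y, hy, rfl, hodd⟩, z, hz, hxz⟩
  have hle := Set.ncard_le_ncard hsub (Set.toFinite _)
  have hA : (G.oddParts u \ A).ncard + A.ncard = (G.oddParts u).ncard :=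
    Set.ncard_sdiff_add_ncard_of_subset (fun K hK => hK.1)
  -- Restoring `x` destroys only the odd components in `A`. The number of odd components drops by at
  -- least 2, and its parity changes, so it drops by at least 3.
  have h3 : 3 ≤ A.ncard := by grind
  rw [← Nat.card_coe_set_eq] at h3
  obtain ⟨f⟩ : Nonempty (Fin 3 ↪ A) := by
    have := Fintype.ofFinite A
    rw [Nat.card_eq_fintype_card] at h3
    exact Function.Embedding.nonempty_of_card_le (by simpa using h3)
  choose y hyK hxy using fun i => (f i).2.2
  choose r hr hK _ using fun i => (f i).2.1
  have hry (i) : (G.avoiding u).Reachable (r i) (y i) := by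
    have := hyK i
    rwa [hK i] at this
  refine ⟨y, fun i => ⟨hxy i, (hry i).notMem_of_avoiding (hr i)⟩, fun i j hij => f.injective ?_⟩
  apply Subtype.ext
  rw [hK i, hK j]
  have hrr : (G.avoiding u).Reachable (r i) (r j) := ((hry i).trans hij).trans (hry j).symm
  ext z
  exact ⟨fun h => hrr.symm.trans h, fun h => hrr.trans h⟩

end SimpleGraph

/-! ### From even multigraphs to Euler families -/

namespace MultiHypergraph

namespace Walk

variable {V E : Type*} {H : MultiHypergraph V E}

/-- The concatenation of two walks. -/
def append {u v w : V} : H.Walk u v → H.Walk v w → H.Walk u w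
  | nil _, q => q
  | cons e hu hv huv p, q => cons e hu hv huv (p.append q)

lemma edges_append {u v w : V} (p : H.Walk u v) (q : H.Walk v w) :
    (p.append q).edges = p.edges ++ q.edges := by
  induction p with
  | nil => rfl
  | cons e hu hv huv p ih => simp [append, edges, ih]

lemma exists_edges_eq_append_of_mem_anchors {u v w : V} (p : H.Walk u w) (hv : v ∈ p.anchors) :
    ∃ (q : H.Walk u v) (r : H.Walk v w), p.edges = q.edges ++ r.edges := by
  induction p with
  | nil u =>
    obtain rfl : v = u := by simpa [anchors] using hv
    exact ⟨nil v, nil v, rfl⟩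
  | cons e hu hw huv p ih =>
    rename_i a b c
    by_cases hva : v = a
    · subst hva
      exact ⟨nil v, cons e hu hw huv p, rfl⟩
    · obtain ⟨q, r, h⟩ := ih (by simpa [anchors, hva] using hv)
      exact ⟨cons e hu hw huv q, r, by simp [edges, h]⟩

lemma eq_of_edges_eq_nil {u w : V} (p : H.Walk u w) (hp : p.edges = []) : u = w := by
  cases p with
  | nil => rfl
  | cons => simp [edges] at hp

end Walk

lemma ClosedTrail.exists_walk_perm {V E : Type*} {H : MultiHypergraph V E} (T : H.ClosedTrail)
    {x : V} (hx : x ∈ T.walk.anchors) : ∃ p : H.Walk x x, p.edges.Perm T.walk.edges := by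
  obtain ⟨q, r, h⟩ := T.walk.exists_edges_eq_append_of_mem_anchors hx
  exact ⟨r.append q, by rw [h, Walk.edges_append]; exact List.perm_append_comm⟩

/-- Two edge-disjoint closed trails with a common anchor can be merged. -/
lemma ClosedTrail.exists_merge {V E : Type*} {H : MultiHypergraph V E} (S T : H.ClosedTrail)
    {x : V} (hS : x ∈ S.walk.anchors) (hT : x ∈ T.walk.anchors)
    (h : (S.walk.edges ++ T.walk.edges).Nodup) :
    ∃ R : H.ClosedTrail, R.walk.edges.Perm (S.walk.edges ++ T.walk.edges) := by
  obtain ⟨p, hp⟩ := S.exists_walk_perm hS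
  obtain ⟨q, hq⟩ := T.exists_walk_perm hT
  have hpq : (p.append q).edges.Perm (S.walk.edges ++ T.walk.edges) := by
    rw [Walk.edges_append]
    exact hp.append hq
  refine ⟨⟨x, p.append q, ?_, hpq.nodup_iff.2 h⟩, hpq⟩
  rw [hpq.length_eq, List.length_append]
  have := S.two_le_length
  omega

/-- A decomposition of the edges into closed trails gives an Euler family. -/
theorem exists_isEulerFamily_of_list {V E : Type*} {H : MultiHypergraph V E}
    (L : List H.ClosedTrail) (hnodup : (L.flatMap fun T => T.walk.edges).Nodup)
    (hmem : ∀ e, e ∈ L.flatMap fun T => T.walk.edges) :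
    ∃ F : Set H.ClosedTrail, H.IsEulerFamily F := by
  induction hl : L.length using Nat.strong_induction_on generalizing L with
  | _ l ih =>
  by_cases hdisj : L.Pairwise fun S T => S.walk.anchors.Disjoint T.walk.anchors
  · refine ⟨{T | T ∈ L}, ?_, fun e => by simpa using hmem e⟩
    have hedges : L.Pairwise fun S T => S.walk.edges.Disjoint T.walk.edges :=
      (List.nodup_flatMap.1 hnodup).2
    intro S hS T hT hne
    have : Std.Symm fun S T : H.ClosedTrail =>
        S.walk.anchors.Disjoint T.walk.anchors ∧ S.walk.edges.Disjoint T.walk.edges :=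
      ⟨fun S T h => ⟨h.1.symm, h.2.symm⟩⟩
    exact (hdisj.and hedges).forall hS hT hne
  · have hpair : ∃ S T L', L.Perm (S :: T :: L') ∧
        ¬ S.walk.anchors.Disjoint T.walk.anchors := by
      clear hnodup hmem ih hl
      induction L with
      | nil => simp at hdisj
      | cons S L ihL =>
        rw [List.pairwise_cons, not_and_or] at hdisj
        rcases hdisj with h | h
        · push Not at h
          obtain ⟨T, hT, h⟩ := h
          obtain ⟨L₁, L₂, rfl⟩ := List.append_of_mem hT
          exact ⟨S, T, L₁ ++ L₂, List.perm_middle.cons S, h⟩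
        · obtain ⟨A, B, L', hL', h⟩ := ihL h
          exact ⟨A, B, S :: L', (hL'.cons S).trans
            ((List.Perm.swap A S _).trans ((List.Perm.swap B S _).cons A)), h⟩
    obtain ⟨S, T, L', hL', hST⟩ := hpair
    obtain ⟨x, hxS, hxT⟩ : ∃ x, x ∈ S.walk.anchors ∧ x ∈ T.walk.anchors := by
      by_contra! h
      exact hST fun x hS hT => h x hS hT
    have hperm := hL'.flatMap_right fun T : H.ClosedTrail => T.walk.edges
    rw [List.flatMap_cons, List.flatMap_cons, ← List.append_assoc] at hperm
    have hnd := hperm.nodup_iff.1 hnodup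
    -- Merging `S` and `T` keeps the edges and lowers the number of trails.
    obtain ⟨R, hR⟩ := S.exists_merge T hxS hxT hnd.of_append_left
    have hperm' : (L.flatMap fun T => T.walk.edges).Perm
        ((R :: L').flatMap fun T => T.walk.edges) := by
      rw [List.flatMap_cons]
      exact hperm.trans (hR.symm.append_right _)
    have hlen := hL'.length_eq
    simp only [List.length_cons] at hlen
    exact ih (R :: L').length (by simp only [List.length_cons]; omega) (R :: L')
      (hperm'.nodup_iff.1 hnodup) (fun e => hperm'.mem_iff.1 (hmem e)) rfl

open Classical in
/-- In the multigraph with edges `a e, b e` for `e ∈ A`, the only odd vertices being `u ≠ w`,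
there is a trail from `u` to `w` whose removal leaves an even multigraph. -/
lemma exists_trail_of_sum_single {V E : Type*} {H : MultiHypergraph V E} {a b : E → V}
    (ha : ∀ e, a e ∈ H.edge e) (hb : ∀ e, b e ∈ H.edge e) (hab : ∀ e, a e ≠ b e)
    (A : Finset E) {u w : V} (huw : u ≠ w)
    (hA : ∑ e ∈ A, (Pi.single (a e) 1 + Pi.single (b e) 1 : V → ZMod 2) =
      Pi.single u 1 + Pi.single w 1) :
    ∃ p : H.Walk u w, p.edges.Nodup ∧ p.edges.toFinset ⊆ A ∧
      ∑ e ∈ A \ p.edges.toFinset, (Pi.single (a e) 1 + Pi.single (b e) 1 : V → ZMod 2) = 0 := by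
  induction hn : A.card generalizing A u with
  | zero =>
    rw [Finset.card_eq_zero.1 hn, Finset.sum_empty] at hA
    have := congrFun hA u
    simp [huw] at this
  | succ n ih =>
    have two (x : V → ZMod 2) : x + x = 0 := by
      ext v
      exact CharTwo.add_self_eq_zero _
    obtain ⟨e, heA, v, hu, hv, huv, hsum⟩ : ∃ e ∈ A, ∃ v, u ∈ H.edge e ∧ v ∈ H.edge e ∧ u ≠ v ∧
        (Pi.single (a e) 1 + Pi.single (b e) 1 : V → ZMod 2) =
          Pi.single u 1 + Pi.single v 1 := by
      -- The coefficient at `u` is 1 modulo 2, so some edge of `A` has `u` as a chosen end.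
      by_contra! hcon
      have h0 := congrFun hA u
      rw [Finset.sum_apply, Finset.sum_eq_zero] at h0
      · simp [huw] at h0
      · intro e he
        have h1 : u ≠ a e := by
          rintro rfl
          exact hcon e he (b e) (ha e) (hb e) (hab e) rfl
        have h2 : u ≠ b e := by
          rintro rfl
          exact hcon e he (a e) (hb e) (ha e) (hab e).symm (add_comm _ _)
        simp [h1, h2]
    -- Removing `e` moves the odd vertex from `u` to `v`.
    have hrest : ∑ e ∈ A.erase e, (Pi.single (a e) 1 + Pi.single (b e) 1 : V → ZMod 2) =
        Pi.single v 1 + Pi.single w 1 := by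
      rw [← Finset.add_sum_erase A _ heA, hsum] at hA
      calc _ = (Pi.single u 1 + Pi.single u 1) + (Pi.single v 1 + Pi.single v 1) +
            ∑ e ∈ A.erase e, (Pi.single (a e) 1 + Pi.single (b e) 1 : V → ZMod 2) := by
              rw [two, two, zero_add, zero_add]
        _ = Pi.single u 1 + Pi.single v 1 + (Pi.single u 1 + Pi.single v 1 +
            ∑ e ∈ A.erase e, (Pi.single (a e) 1 + Pi.single (b e) 1 : V → ZMod 2)) := by abel
        _ = (Pi.single u 1 + Pi.single u 1) + (Pi.single v 1 + Pi.single w 1) := by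
              rw [hA]; abel
        _ = _ := by rw [two, zero_add]
    by_cases hvw : v = w
    · subst hvw
      refine ⟨.cons e hu hv huv (.nil v), by simp [Walk.edges], by simpa [Walk.edges], ?_⟩
      rw [two] at hrest
      simpa [Walk.edges, Finset.sdiff_singleton_eq_erase] using hrest
    · obtain ⟨p, hp, hpA, hpsum⟩ := ih (A.erase e) hvw hrest (by
        rw [Finset.card_erase_of_mem heA, hn]; rfl)
      have hep : e ∉ p.edges := fun h =>
        (Finset.mem_erase.1 (hpA (List.mem_toFinset.2 h))).1 rfl
      refine ⟨.cons e hu hv huv p, by simp [Walk.edges, hp, hep], ?_, ?_⟩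
      · rw [Walk.edges, List.toFinset_cons, Finset.insert_subset_iff]
        exact ⟨heA, hpA.trans (Finset.erase_subset _ _)⟩
      · rw [Walk.edges, List.toFinset_cons]
        have : A \ insert e p.edges.toFinset = A.erase e \ p.edges.toFinset := by
          ext; simp; tauto
        rwa [this]

open Classical in
/-- An even multigraph whose edges are chosen inside the edges of a hypergraph decomposes into
closed trails. -/
lemma exists_closedTrail_list {V E : Type*} {H : MultiHypergraph V E} {a b : E → V}
    (ha : ∀ e, a e ∈ H.edge e) (hb : ∀ e, b e ∈ H.edge e) (hab : ∀ e, a e ≠ b e) (A : Finset E)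
    (hA : ∑ e ∈ A, (Pi.single (a e) 1 + Pi.single (b e) 1 : V → ZMod 2) = 0) :
    ∃ L : List H.ClosedTrail, (L.flatMap fun T => T.walk.edges).Nodup ∧
      ∀ e, e ∈ (L.flatMap fun T => T.walk.edges) ↔ e ∈ A := by
  induction hn : A.card using Nat.strong_induction_on generalizing A with
  | _ n ih =>
  obtain rfl | ⟨e, he⟩ := A.eq_empty_or_nonempty
  · exact ⟨[], by simp, by simp⟩
  -- Without `e`, exactly the two ends of `e` are odd, so a trail between them closes up with `e`.
  have hsum : ∑ e ∈ A.erase e, (Pi.single (a e) 1 + Pi.single (b e) 1 : V → ZMod 2) =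
      Pi.single (b e) 1 + Pi.single (a e) 1 := by
    rw [← Finset.add_sum_erase A _ he] at hA
    have := eq_neg_of_add_eq_zero_right hA
    rw [this]
    ext v
    simp only [Pi.neg_apply, ZMod.neg_eq_self_mod_two]
    rw [add_comm]
  obtain ⟨p, hp, hpA, hpsum⟩ := exists_trail_of_sum_single ha hb hab (A.erase e)
    (hab e).symm hsum
  have hep : e ∉ p.edges := fun h => (Finset.mem_erase.1 (hpA (List.mem_toFinset.2 h))).1 rfl
  have hlen : 2 ≤ (Walk.cons e (ha e) (hb e) (hab e) p).edges.length := by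
    cases hq : p.edges with
    | nil =>
      exfalso
      exact hab e (p.eq_of_edges_eq_nil hq).symm
    | cons => simp [Walk.edges, hq]
  let T : H.ClosedTrail := ⟨a e, .cons e (ha e) (hb e) (hab e) p, hlen,
    by simp [Walk.edges, hp, hep]⟩
  have hT : T.walk.edges = e :: p.edges := rfl
  have hlt : (A.erase e \ p.edges.toFinset).card < n := by
    have h1 := Finset.card_le_card (Finset.sdiff_subset (s := A.erase e) (t := p.edges.toFinset))
    have h2 := Finset.card_erase_lt_of_mem he
    omega
  obtain ⟨L, hL, hmem⟩ := ih _ hlt _ hpsum rfl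
  refine ⟨T :: L, ?_, fun f => ?_⟩
  · rw [List.flatMap_cons, List.nodup_append']
    refine ⟨T.edges_nodup, hL, fun f hf hfL => ?_⟩
    rw [hmem, Finset.mem_sdiff, Finset.mem_erase, List.mem_toFinset] at hfL
    rw [hT, List.mem_cons] at hf
    tauto
  · have hsub : f ∈ p.edges → f ∈ A := fun h =>
      Finset.mem_of_mem_erase (hpA (List.mem_toFinset.2 h))
    rw [List.flatMap_cons, List.mem_append, hmem, hT, List.mem_cons, Finset.mem_sdiff,
      Finset.mem_erase, List.mem_toFinset]
    by_cases hfe : f = e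
    · simp [hfe, he]
    · tauto

open Classical in
/-- A hypergraph is quasi-eulerian if one can choose two vertices in each edge so that every
vertex is chosen an even number of times. -/
theorem isQuasiEulerian_of_sum_single {V E : Type*} [Fintype E] {H : MultiHypergraph V E}
    {a b : E → V} (ha : ∀ e, a e ∈ H.edge e) (hb : ∀ e, b e ∈ H.edge e) (hab : ∀ e, a e ≠ b e)
    (h : ∑ e, (Pi.single (a e) 1 + Pi.single (b e) 1 : V → ZMod 2) = 0) :
    H.IsQuasiEulerian := by
  obtain ⟨L, hL, hmem⟩ := exists_closedTrail_list ha hb hab Finset.univ h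
  exact Or.inr (exists_isEulerFamily_of_list L hL fun e => (hmem e).2 (Finset.mem_univ e))

end MultiHypergraph

namespace MultiHypergraph

/-! ### Cut edges -/

section CutEdge

variable {V E : Type*} {H : MultiHypergraph V E}

lemma Walk.nonempty_symm {u v : V} (p : H.Walk u v) : Nonempty (H.Walk v u) := by
  induction p with
  | nil u => exact ⟨.nil u⟩
  | cons e hu hv huv p ih => exact ih.map fun q => q.append (.cons e hv hu huv.symm (.nil _))

lemma Walk.nonempty_of_deleteEdge {e : E} {u v : V} (p : (H.deleteEdge e).Walk u v) :
    Nonempty (H.Walk u v) := by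
  induction p with
  | nil u => exact ⟨.nil u⟩
  | cons e hu hv huv p ih => exact ih.map fun q => .cons e.1 hu hv huv q

lemma setOf_nonempty_walk_eq {u v : V} (p : H.Walk u v) :
    {x | Nonempty (H.Walk u x)} = {x | Nonempty (H.Walk v x)} := by
  obtain ⟨q⟩ := p.nonempty_symm
  ext x
  exact ⟨fun ⟨r⟩ => ⟨q.append r⟩, fun ⟨r⟩ => ⟨p.append r⟩⟩

/-- An edge is a cut edge if its removal disconnects two connected vertices. -/
theorem isCutEdge_of_isEmpty_walk [Finite V] {e : E} {v w : V} (p : H.Walk v w)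
    (h : IsEmpty ((H.deleteEdge e).Walk v w)) : H.IsCutEdge e := by
  -- `f` maps each component of `H.deleteEdge e` to the component of `H` containing it. It is onto;
  -- equal counts would make it injective, although it identifies the components of `v` and `w`.
  let f : Set V → Set V := fun C => {y | ∃ x ∈ C, Nonempty (H.Walk x y)}
  have hf (u : V) : f {x | Nonempty ((H.deleteEdge e).Walk u x)} = {x | Nonempty (H.Walk u x)} := by
    ext y
    constructor
    · rintro ⟨x, ⟨q⟩, ⟨r⟩⟩
      exact q.nonempty_of_deleteEdge.map fun q => q.append r
    · exact fun hy => ⟨u, ⟨.nil u⟩, hy⟩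
  have himage : {C : Set V | ∃ u, C = {x | Nonempty (H.Walk u x)}} =
      f '' {C : Set V | ∃ u, C = {x | Nonempty ((H.deleteEdge e).Walk u x)}} := by
    ext C
    constructor
    · rintro ⟨u, rfl⟩
      exact ⟨_, ⟨u, rfl⟩, hf u⟩
    · rintro ⟨_, ⟨u, rfl⟩, rfl⟩
      exact ⟨u, hf u⟩
  rw [IsCutEdge, numComponents, numComponents, himage]
  refine lt_of_le_of_ne (Set.ncard_image_le (Set.toFinite _)) fun heq => ?_
  have hinj := Set.injOn_of_ncard_image_eq heq (Set.toFinite _)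
  have hvw := hinj ⟨v, rfl⟩ ⟨w, rfl⟩ (by rw [hf, hf, setOf_nonempty_walk_eq p])
  have hw : w ∈ {x | Nonempty ((H.deleteEdge e).Walk v x)} := by
    rw [hvw]
    exact ⟨.nil w⟩
  exact h.false hw.some

/-- If every edge other than `e` that meets `W` lies in `W`, and `e` has vertices inside and
outside of `W`, then `e` is a cut edge. -/
theorem isCutEdge_of_closed [Finite V] {e : E} (W : Set V) {v w : V} (hv : v ∈ H.edge e)
    (hw : w ∈ H.edge e) (hvW : v ∈ W) (hwW : w ∉ W)
    (h : ∀ f ≠ e, ∀ x ∈ H.edge f, ∀ y ∈ H.edge f, x ∈ W → y ∈ W) : H.IsCutEdge e := by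
  have hne : v ≠ w := by
    rintro rfl
    exact hwW hvW
  refine isCutEdge_of_isEmpty_walk (.cons e hv hw hne (.nil w)) ⟨fun p => ?_⟩
  clear hv hw hne
  induction p with
  | nil => exact hwW hvW
  | cons f hx hy hxy p ih => exact ih (h f.1 f.2 _ hx _ hy hvW) hwW

end CutEdge

/-! ### The matching gadget and the shape of its minimal barriers -/

section Gadget

variable {V E : Type*}

/-- The graph whose perfect matchings describe Euler families: each vertex `v` is replaced by a
clique on the `(v, e, b)`, and each edge `e` by two vertices `(e, i)`, both adjacent to
`(v, e, true)` for all `v ∈ e`. -/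
def matchingGadget (H : MultiHypergraph V E) : SimpleGraph (V × E × Bool ⊕ E × Bool) where
  Adj
    | .inl x, .inl y => x.1 = y.1 ∧ x.2 ≠ y.2
    | .inl x, .inr y => x.1 ∈ H.edge y.1 ∧ x.2 = (y.1, true)
    | .inr y, .inl x => x.1 ∈ H.edge y.1 ∧ x.2 = (y.1, true)
    | .inr _, .inr _ => False
  symm := ⟨by
    rintro (x | x) (y | y) h
    · exact ⟨h.1.symm, h.2.symm⟩
    · exact h
    · exact h
    · exact h⟩
  loopless := ⟨by
    rintro (x | x) h
    · exact h.2 rfl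
    · exact h⟩

open Classical in
theorem isQuasiEulerian_of_isPerfectMatching [Fintype V] [Fintype E] {H : MultiHypergraph V E}
    {M : H.matchingGadget.Subgraph} (hM : M.IsPerfectMatching) : H.IsQuasiEulerian := by
  choose σ hσ hσ' using fun x => hM.1 (hM.2 x)
  simp only at hσ'
  have hinv (x) : σ (σ x) = x := (hσ' _ _ (hσ x).symm).symm
  have hend (p : E × Bool) : ∃ v ∈ H.edge p.1, σ (.inr p) = .inl (v, p.1, true) := by
    have h := M.adj_sub (hσ (.inr p))
    generalize σ (.inr p) = y at h
    rcases y with ⟨v, x⟩ | y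
    · obtain ⟨h1, rfl⟩ : v ∈ H.edge p.1 ∧ x = (p.1, true) := h
      exact ⟨v, h1, rfl⟩
    · exact h.elim
  choose c hc hσc using hend
  refine isQuasiEulerian_of_sum_single (a := fun e => c (e, true)) (b := fun e => c (e, false))
    (fun e => hc _) (fun e => hc _) (fun e he => ?_) ?_
  · have h := hσc (e, true)
    rw [show c (e, true) = c (e, false) from he, ← hσc (e, false)] at h
    have := congrArg σ h
    rw [hinv, hinv] at this
    simp at this
  · ext v
    -- The indicator of `v` on the cliques, extended to each twin by the value at its partner. It
    -- agrees on matched pairs, so its total is 0 modulo 2; the cliques contribute evenly, which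
    -- leaves the number of times `v` is chosen.
    let g : V × E × Bool ⊕ E × Bool → ZMod 2 :=
      Sum.elim (fun x => if x.1 = v then 1 else 0) (fun p => if c p = v then 1 else 0)
    have hg (x) : g (σ x) = g x := by
      rcases x with x | p
      · have h := M.adj_sub (hσ (.inl x))
        rcases hy : σ (.inl x) with y | p
        · rw [hy] at h
          have h1 : x.1 = y.1 := h.1
          simp [g, h1]
        · have h2 := hinv (.inl x)
          rw [hy, hσc] at h2
          simp only [Sum.inl.injEq] at h2
          simp [g, ← h2]
      · rw [hσc]
        rfl
    have hsum : ∑ x, g x = 0 := by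
      refine Finset.sum_involution (fun x _ => σ x) (fun x _ => ?_) (fun x _ _ hx => ?_)
        (fun x _ => Finset.mem_univ _) (fun x _ => hinv x)
      · rw [hg]
        exact CharTwo.add_self_eq_zero _
      · have := hσ x
        rw [hx] at this
        exact this.ne rfl
    rw [Fintype.sum_sum_type, Fintype.sum_prod_type, Finset.sum_eq_zero, zero_add,
      Fintype.sum_prod_type] at hsum
    · rw [Finset.sum_apply]
      refine Eq.trans (Finset.sum_congr rfl fun e _ => ?_) hsum
      simp only [Fintype.sum_bool, g, Sum.elim_inr, Pi.add_apply, Pi.single_apply, eq_comm (a := v)]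
    · intro x _
      rw [Fintype.sum_prod_type]
      refine Finset.sum_eq_zero fun e _ => ?_
      rw [Fintype.sum_bool]
      exact CharTwo.add_self_eq_zero _

/-- The set of vertices of the gadget graph formed by the pairs replacing the edges in `S`, and by
the incidences with the edges in `T`. -/
def barrier (H : MultiHypergraph V E) (S T : Set E) : Set (V × E × Bool ⊕ E × Bool)
  | .inl x => x.2.2 = true ∧ x.2.1 ∈ T ∧ x.1 ∈ H.edge x.2.1
  | .inr p => p.1 ∈ S

lemma inl_mem_barrier {H : MultiHypergraph V E} {S T : Set E} {v : V} {e : E} {b : Bool} :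
    .inl (v, e, b) ∈ H.barrier S T ↔ b = true ∧ e ∈ T ∧ v ∈ H.edge e := Iff.rfl

lemma inr_mem_barrier {H : MultiHypergraph V E} {S T : Set E} {e : E} {i : Bool} :
    .inr (e, i) ∈ H.barrier S T ↔ e ∈ S := Iff.rfl

/-- Since these copies are never deleted, (v, e₀, false) with `e₀` fixed can represent `v` among the
remaining components. -/
lemma inl_false_notMem_barrier {H : MultiHypergraph V E} {S T : Set E} {v : V} {e : E} :
    .inl (v, e, false) ∉ H.barrier S T := fun h => Bool.false_ne_true h.1

lemma matchingGadget_adj_inl_inr {H : MultiHypergraph V E} {v : V} {e f : E} {b i : Bool} :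
    H.matchingGadget.Adj (.inl (v, e, b)) (.inr (f, i)) ↔ v ∈ H.edge f ∧ e = f ∧ b = true := by
  change (v ∈ H.edge f ∧ (e, b) = (f, true)) ↔ _
  rw [Prod.mk.injEq]

lemma matchingGadget_adj_inr {H : MultiHypergraph V E} {f : E} {i : Bool}
    {x : V × E × Bool ⊕ E × Bool} :
    H.matchingGadget.Adj (.inr (f, i)) x ↔ ∃ v ∈ H.edge f, x = .inl (v, f, true) := by
  constructor
  · rcases x with ⟨v, e, b⟩ | y
    · rintro ⟨h1, h2⟩
      simp only at h1 h2
      exact ⟨v, h1, by rw [h2]⟩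
    · exact fun h => h.elim
  · rintro ⟨v, hv, rfl⟩
    exact ⟨hv, rfl⟩

lemma reachable_inl {H : MultiHypergraph V E} {u : Set (V × E × Bool ⊕ E × Bool)}
    {v : V} {x y : E × Bool} (hx : .inl (v, x) ∉ u) (hy : .inl (v, y) ∉ u) :
    (H.matchingGadget.avoiding u).Reachable (.inl (v, x)) (.inl (v, y)) := by
  by_cases hxy : x = y
  · subst hxy
    exact .refl _
  · exact SimpleGraph.Adj.reachable ⟨⟨rfl, hxy⟩, hx, hy⟩

/-- The condition of neighbours in three components forces twins to be deleted together, and the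
incidences of an edge to be deleted all at once, in which case its twins survive. -/
theorem exists_barrier [Finite V] [Finite E] (H : MultiHypergraph V E)
    (h : ∀ M : H.matchingGadget.Subgraph, ¬ M.IsPerfectMatching) :
    ∃ S T : Set E, Disjoint S T ∧
      (H.barrier S T).ncard < (H.matchingGadget.oddParts (H.barrier S T)).ncard := by
  obtain ⟨u, hu, hN⟩ := SimpleGraph.exists_oddParts_of_forall_not_isPerfectMatching _ h
  have hinl {v : V} {e : E} {b : Bool} (hx : .inl (v, e, b) ∈ u) : b = true ∧ v ∈ H.edge e ∧
      (∀ i, .inr (e, i) ∉ u) ∧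
      ¬ (H.matchingGadget.avoiding u).Reachable (.inr (e, false)) (.inr (e, true)) := by
    obtain ⟨y, hy, hinj⟩ := hN _ hx
    -- Clique neighbours share the colour `none` and the twins get `some i`. Neighbours of equal
    -- colour lie in one component, so three components use all three colours: both twins are
    -- neighbours, survive, and are separated.
    let c : V × E × Bool ⊕ E × Bool → Option Bool := Sum.elim (fun _ => none) (fun p => some p.2)
    have hc : Function.Injective (c ∘ y) := by
      intro i j hij
      refine hinj i j ?_
      have hi := hy i
      have hj := hy j
      simp only [Function.comp] at hij
      generalize y i = yi at *
      generalize y j = yj at *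
      rcases yi with ⟨v1, x1⟩ | ⟨f1, i1⟩ <;> rcases yj with ⟨v2, x2⟩ | ⟨f2, i2⟩
      · obtain rfl : v = v1 := hi.1.1
        obtain rfl : v = v2 := hj.1.1
        exact reachable_inl hi.2 hj.2
      · simp [c] at hij
      · simp [c] at hij
      · obtain rfl : i1 = i2 := by simpa [c] using hij
        obtain rfl := (matchingGadget_adj_inl_inr.1 hi.1).2.1
        obtain rfl := (matchingGadget_adj_inl_inr.1 hj.1).2.1
        exact .refl _
    have hsurj : Function.Surjective (c ∘ y) :=
      ((Fintype.bijective_iff_injective_and_card _).2 ⟨hc, by simp⟩).2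
    have hval (i : Bool) : ∃ j, y j = .inr (e, i) ∧ v ∈ H.edge e ∧ b = true := by
      obtain ⟨j, hj⟩ := hsurj (some i)
      have hyj := (hy j).1
      simp only [Function.comp] at hj
      refine ⟨j, ?_⟩
      generalize y j = yj at *
      rcases yj with x | ⟨f, i'⟩
      · simp [c] at hj
      · obtain ⟨h1, rfl, h2⟩ := matchingGadget_adj_inl_inr.1 hyj
        obtain rfl : i' = i := by simpa [c] using hj
        exact ⟨rfl, h1, h2⟩
    obtain ⟨j, hj, hv, hb⟩ := hval false
    obtain ⟨j', hj', -, -⟩ := hval true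
    refine ⟨hb, hv, fun i => ?_, fun hr => ?_⟩
    · obtain ⟨l, hl, -⟩ := hval i
      rw [← hl]
      exact (hy l).2
    · rw [← hj, ← hj'] at hr
      obtain rfl := hinj _ _ hr
      rw [hj] at hj'
      simp at hj'
  have hinr {e : E} {i : Bool} (hx : .inr (e, i) ∈ u) (i' : Bool) : .inr (e, i') ∈ u := by
    by_contra hi'
    obtain ⟨y, hy, hinj⟩ := hN _ hx
    -- Twins have the same neighbours, so a surviving twin joins all surviving neighbours of the
    -- deleted one.
    have hr (j) : (H.matchingGadget.avoiding u).Reachable (.inr (e, i')) (y j) := by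
      have h1 := (hy j).1
      rw [matchingGadget_adj_inr] at h1
      exact SimpleGraph.Adj.reachable ⟨matchingGadget_adj_inr.2 h1, hi', (hy j).2⟩
    exact absurd (hinj 0 1 ((hr 0).symm.trans (hr 1))) (by decide)
  have hall {v w : V} {e : E} (hv : .inl (v, e, true) ∈ u) (hw : w ∈ H.edge e) :
      .inl (w, e, true) ∈ u := by
    -- A surviving incidence vertex would connect the twins that `hinl` separates.
    by_contra hwu
    obtain ⟨-, -, h1, h2⟩ := hinl hv
    have hr (i) : (H.matchingGadget.avoiding u).Reachable (.inr (e, i)) (.inl (w, e, true)) :=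
      SimpleGraph.Adj.reachable ⟨matchingGadget_adj_inr.2 ⟨w, hw, rfl⟩, h1 i, hwu⟩
    exact h2 ((hr _).trans (hr _).symm)
  have hbarrier : H.barrier {e | .inr (e, false) ∈ u} {e | ∃ v, .inl (v, e, true) ∈ u} = u := by
    ext x
    rcases x with ⟨v, e, b⟩ | ⟨e, i⟩
    · rw [inl_mem_barrier]
      constructor
      · rintro ⟨rfl, ⟨w, hw⟩, hv⟩
        exact hall hw hv
      · intro hx
        obtain ⟨rfl, hv, -⟩ := hinl hx
        exact ⟨rfl, ⟨v, hx⟩, hv⟩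
    · rw [inr_mem_barrier]
      exact ⟨fun hx => hinr hx i, fun hx => hinr hx false⟩
  refine ⟨{e | .inr (e, false) ∈ u}, {e | ∃ v, .inl (v, e, true) ∈ u}, ?_, ?_⟩
  · rw [Set.disjoint_left]
    rintro e he ⟨v, hv⟩
    exact (hinl hv).2.2.1 false he
  · rw [hbarrier]
    exact hu

/-- The vertices of the hypergraph that a set of vertices of the gadget graph contains. -/
def trace (e₀ : E) (K : Set (V × E × Bool ⊕ E × Bool)) : Set V := {v | .inl (v, e₀, false) ∈ K}

lemma mem_trace {e₀ : E} {K : Set (V × E × Bool ⊕ E × Bool)} {v : V} :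
    v ∈ trace e₀ K ↔ .inl (v, e₀, false) ∈ K := Iff.rfl

end Gadget

end MultiHypergraph

/-! ### Odd components as disjoint classes -/

namespace SimpleGraph

lemma eq_of_mem_oddParts {α : Type*} {G : SimpleGraph α} {u K L : Set α} {x : α}
    (hK : K ∈ G.oddParts u) (hL : L ∈ G.oddParts u) (hxK : x ∈ K) (hxL : x ∈ L) : K = L := by
  obtain ⟨y, -, rfl, -⟩ := hK
  obtain ⟨z, -, rfl, -⟩ := hL
  have hyz : (G.avoiding u).Reachable y z := Reachable.trans hxK (Reachable.symm hxL)
  ext t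
  exact ⟨fun h => hyz.symm.trans h, fun h => hyz.trans h⟩

lemma mem_of_mem_oddParts {α : Type*} {G : SimpleGraph α} {u K : Set α} {x y : α}
    (hK : K ∈ G.oddParts u) (hx : x ∈ K) (hxy : (G.avoiding u).Reachable x y) : y ∈ K := by
  obtain ⟨z, -, rfl, -⟩ := hK
  exact Reachable.trans hx hxy

lemma notMem_of_mem_oddParts {α : Type*} {G : SimpleGraph α} {u K : Set α} {x : α}
    (hK : K ∈ G.oddParts u) (hx : x ∈ K) : x ∉ u := by
  obtain ⟨z, hz, rfl, -⟩ := hK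
  exact Reachable.notMem_of_avoiding hx hz

end SimpleGraph

namespace MultiHypergraph

open Classical

/-! ### Counting components and incidences at a barrier -/

section Barrier

variable {V E : Type*} [Fintype V] [Fintype E] {H : MultiHypergraph V E}

/-- The incidences with the edges in `A`. -/
noncomputable def incidences (H : MultiHypergraph V E) (A : Finset E) : Finset (V × E) :=
  Finset.univ.filter fun p => p.2 ∈ A ∧ p.1 ∈ H.edge p.2

lemma mem_incidences {A : Finset E} {p : V × E} :
    p ∈ H.incidences A ↔ p.2 ∈ A ∧ p.1 ∈ H.edge p.2 := by
  simp [incidences]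

lemma card_incidences {k : ℕ} (hk : H.IsUniform k) (A : Finset E) :
    (H.incidences A).card = k * A.card := by
  have hmaps : ∀ p ∈ H.incidences A, p.2 ∈ A := fun p hp => (mem_incidences.1 hp).1
  rw [Finset.card_eq_sum_card_fiberwise hmaps, Finset.sum_const_nat (m := k), mul_comm]
  intro e he
  rw [← hk e]
  refine Finset.card_nbij' (fun p => p.1) (fun v => (v, e)) ?_ ?_ ?_ ?_
  · intro p hp
    obtain ⟨h1, h2⟩ := Finset.mem_filter.1 hp
    rw [← h2]
    exact (mem_incidences.1 h1).2
  · intro v hv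
    exact Finset.mem_filter.2 ⟨mem_incidences.2 ⟨he, hv⟩, rfl⟩
  · intro p hp
    obtain ⟨h1, h2⟩ := Finset.mem_filter.1 hp
    simp [← h2]
  · intro v hv
    rfl

lemma le_ncard_barrier {k : ℕ} (hk : H.IsUniform k) (S T : Finset E) :
    2 * S.card + k * T.card ≤ (H.barrier S T).ncard := by
  have hinj : Function.Injective fun p : V × E => (p.1, p.2, true) := by
    rintro ⟨v, e⟩ ⟨w, f⟩ h
    simpa using h
  rw [← card_incidences hk, ← Finset.card_image_of_injective _ hinj,
    show 2 * S.card = (S ×ˢ (Finset.univ : Finset Bool)).card by simp [mul_comm], add_comm,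
    ← Finset.card_disjSum, ← Set.ncard_coe_finset]
  refine Set.ncard_le_ncard ?_ (Set.toFinite _)
  rintro (x | x) hx
  · rw [Finset.mem_coe, Finset.inl_mem_disjSum, Finset.mem_image] at hx
    obtain ⟨p, hp, rfl⟩ := hx
    exact ⟨rfl, mem_incidences.1 hp⟩
  · rw [Finset.mem_coe, Finset.inr_mem_disjSum, Finset.mem_product] at hx
    exact hx.1

/-- The odd components outside of a barrier that contain vertices of the hypergraph. -/
noncomputable def largeParts (H : MultiHypergraph V E) (S T : Set E) (e₀ : E) :
    Finset (Set (V × E × Bool ⊕ E × Bool)) :=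
  Finset.univ.filter fun K =>
    K ∈ H.matchingGadget.oddParts (H.barrier S T) ∧ (trace e₀ K).Nonempty

lemma mem_largeParts {S T : Set E} {e₀ : E} {K : Set (V × E × Bool ⊕ E × Bool)} :
    K ∈ H.largeParts S T e₀ ↔
      K ∈ H.matchingGadget.oddParts (H.barrier S T) ∧ (trace e₀ K).Nonempty := by
  simp [largeParts]

lemma reachable_inr {S T : Set E} {v : V} {e : E} {i : Bool} (e₀ : E) (hS : e ∉ S) (hT : e ∉ T)
    (hv : v ∈ H.edge e) : (H.matchingGadget.avoiding (H.barrier S T)).Reachable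
      (.inr (e, i)) (.inl (v, e₀, false)) := by
  have hve : .inl (v, e, true) ∉ H.barrier S T := fun h => hT h.2.1
  have hadj : (H.matchingGadget.avoiding (H.barrier S T)).Adj (.inr (e, i)) (.inl (v, e, true)) :=
    ⟨matchingGadget_adj_inr.2 ⟨v, hv, rfl⟩, hS, hve⟩
  exact hadj.reachable.trans (reachable_inl hve inl_false_notMem_barrier)

/-- A component without hypergraph vertices can only be a twin of an edge in `T`, isolated because
all its neighbours are deleted. -/
lemma ncard_oddParts_barrier_le {k : ℕ} (hk : H.IsUniform k) (hk0 : 0 < k) (S T : Finset E)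
    (e₀ : E) : (H.matchingGadget.oddParts (H.barrier S T)).ncard ≤
      (H.largeParts S T e₀).card + 2 * T.card := by
  let A : Finset (Set (V × E × Bool ⊕ E × Bool)) :=
    (T ×ˢ (Finset.univ : Finset Bool)).image fun p => {.inr p}
  have hA : A.card ≤ 2 * T.card := Finset.card_image_le.trans (by simp [mul_comm])
  have hsub : H.matchingGadget.oddParts (H.barrier S T) ⊆ ↑(H.largeParts S T e₀ ∪ A) := by
    intro K hK
    rw [Finset.mem_coe, Finset.mem_union, mem_largeParts]
    obtain ⟨x, hx, hKx, hodd⟩ := id hK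
    have hlarge {v : V} (h : (H.matchingGadget.avoiding (H.barrier S T)).Reachable x
        (.inl (v, e₀, false))) : K ∈ H.matchingGadget.oddParts (H.barrier S T) ∧
          (trace e₀ K).Nonempty := by
      refine ⟨hK, v, ?_⟩
      rw [hKx]
      exact h
    rcases x with ⟨v, x⟩ | ⟨e, i⟩
    · exact Or.inl (hlarge (reachable_inl hx inl_false_notMem_barrier))
    · by_cases hT : e ∈ T
      · refine Or.inr (Finset.mem_image.2 ⟨(e, i), by simp [hT], ?_⟩)
        rw [hKx]
        ext y
        constructor
        · rintro rfl
          exact .refl _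
        · rintro ⟨p⟩
          cases p with
          | nil => rfl
          | cons h p =>
            obtain ⟨v, hv, rfl⟩ := matchingGadget_adj_inr.1 h.1
            exact absurd (inl_mem_barrier.2 ⟨rfl, Finset.mem_coe.2 hT, hv⟩) h.2.2
      · obtain ⟨v, hv⟩ : (H.edge e).Nonempty := by
          rw [← Finset.card_pos, hk e]
          exact hk0
        exact Or.inl (hlarge (reachable_inr e₀ hx hT hv))
  calc _ ≤ (H.largeParts S T e₀ ∪ A).card := by
        rw [← Set.ncard_coe_finset]
        exact Set.ncard_le_ncard hsub (Set.toFinite _)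
    _ ≤ _ := (Finset.card_union_le _ _).trans (by omega)

lemma sum_card_incidences_trace_le {k : ℕ} (hk : H.IsUniform k) (S T : Set E) (e₀ : E)
    (A : Finset E) : ∑ K ∈ H.largeParts S T e₀,
      ((H.incidences A).filter fun p => p.1 ∈ trace e₀ K).card ≤ k * A.card := by
  rw [← card_incidences hk, ← Finset.card_biUnion]
  · refine Finset.card_le_card fun p hp => ?_
    obtain ⟨K, -, hp⟩ := Finset.mem_biUnion.1 hp
    exact (Finset.mem_filter.1 hp).1
  · intro K hK L hL hKL
    rw [Function.onFun, Finset.disjoint_left]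
    intro p hpK hpL
    exact hKL (SimpleGraph.eq_of_mem_oddParts (mem_largeParts.1 hK).1 (mem_largeParts.1 hL).1
      (Finset.mem_filter.1 hpK).2 (Finset.mem_filter.1 hpL).2)

lemma mem_trace_of_mem_edge {S T : Set E} {e₀ e : E} {K : Set (V × E × Bool ⊕ E × Bool)}
    (hK : K ∈ H.matchingGadget.oddParts (H.barrier S T)) (hS : e ∉ S) (hT : e ∉ T) {v w : V}
    (hv : v ∈ H.edge e) (hw : w ∈ H.edge e) (hvK : v ∈ trace e₀ K) : w ∈ trace e₀ K :=
  mem_trace.2 (SimpleGraph.mem_of_mem_oddParts hK (mem_trace.1 hvK)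
    ((reachable_inr (i := true) e₀ hS hT hv).symm.trans (reachable_inr e₀ hS hT hw)))

lemma odd_card_incidences_trace {S T : Finset E} {e₀ : E}
    {K : Set (V × E × Bool ⊕ E × Bool)} (hK : K ∈ H.largeParts S T e₀) :
    Odd ((H.incidences T).filter fun p => p.1 ∈ trace e₀ K).card := by
  obtain ⟨hKo, v₀, hv₀⟩ := mem_largeParts.1 hK
  have hodd : Odd K.ncard := by
    obtain ⟨-, -, -, h⟩ := id hKo
    exact h
  let W : Finset V := Finset.univ.filter fun v => v ∈ trace e₀ K
  let F : Finset E := Finset.univ.filter fun e => e ∉ S ∧ e ∉ T ∧ ∃ v ∈ H.edge e, v ∈ trace e₀ K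
  -- The full cliques over the trace together with the twin pairs attached to them: an even set, and
  -- the disjoint union of `K` and the deleted incidence vertices `D`. As `K` is odd, so is `D`.
  let Z : Finset (V × E × Bool ⊕ E × Bool) :=
    (W ×ˢ (Finset.univ : Finset (E × Bool))).disjSum (F ×ˢ (Finset.univ : Finset Bool))
  let D : Finset (V × E × Bool ⊕ E × Bool) :=
    ((H.incidences T).filter fun p => p.1 ∈ trace e₀ K).image fun p => .inl (p.1, p.2, true)
  have hD : D.card = ((H.incidences T).filter fun p => p.1 ∈ trace e₀ K).card := by
    refine Finset.card_image_of_injective _ ?_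
    rintro ⟨v, e⟩ ⟨w, f⟩ h
    simpa using h
  have hZ : Even Z.card := by
    rw [Finset.card_disjSum, Finset.card_product, Finset.card_product, Finset.card_univ,
      Fintype.card_prod, Finset.card_univ, Fintype.card_bool, ← mul_assoc]
    exact (even_two.mul_left _).add (even_two.mul_left _)
  have hDu {x} (hx : x ∈ D) : x ∈ H.barrier S T := by
    obtain ⟨p, hp, rfl⟩ := Finset.mem_image.1 hx
    exact ⟨rfl, mem_incidences.1 (Finset.mem_filter.1 hp).1⟩
  have hinl {v : V} {x : E × Bool} (h : .inl (v, x) ∉ H.barrier S T) :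
      .inl (v, x) ∈ K ↔ v ∈ trace e₀ K :=
    ⟨fun hx => mem_trace.2
        (SimpleGraph.mem_of_mem_oddParts hKo hx (reachable_inl h inl_false_notMem_barrier)),
      fun hx => SimpleGraph.mem_of_mem_oddParts hKo (mem_trace.1 hx)
        (reachable_inl inl_false_notMem_barrier h)⟩
  have hZKD : Z = K.toFinset ∪ D := by
    ext x
    rw [Finset.mem_union, Set.mem_toFinset]
    rcases x with ⟨v, e, b⟩ | ⟨e, i⟩
    · have h1 : .inl (v, e, b) ∈ Z ↔ v ∈ trace e₀ K := by simp [Z, W]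
      rw [h1]
      by_cases hu : .inl (v, e, b) ∈ H.barrier S T
      · have h2 : .inl (v, e, b) ∉ K := fun h => SimpleGraph.notMem_of_mem_oddParts hKo h hu
        obtain ⟨rfl, h3⟩ := inl_mem_barrier.1 hu
        have h4 : .inl (v, e, true) ∈ D ↔ v ∈ trace e₀ K := by
          constructor
          · intro h
            obtain ⟨⟨w, f⟩, hp, hwf⟩ := Finset.mem_image.1 h
            obtain ⟨rfl, rfl⟩ : w = v ∧ f = e := by simpa using hwf
            exact (Finset.mem_filter.1 hp).2
          · exact fun h => Finset.mem_image.2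
              ⟨(v, e), Finset.mem_filter.2 ⟨mem_incidences.2 h3, h⟩, rfl⟩
        rw [h4]
        tauto
      · rw [hinl hu]
        exact ⟨Or.inl, fun h => h.elim id fun h => absurd (hDu h) hu⟩
    · have h1 : .inr (e, i) ∉ D := fun h => by
        obtain ⟨p, -, hp⟩ := Finset.mem_image.1 h
        simp at hp
      have h2 : (Sum.inr (e, i) : V × E × Bool ⊕ E × Bool) ∈ Z ↔ e ∈ F := by simp [Z]
      rw [h2, or_iff_left h1, Finset.mem_filter]
      constructor
      · rintro ⟨-, hS, hT, v, hv, hvK⟩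
        exact SimpleGraph.mem_of_mem_oddParts hKo hvK (reachable_inr e₀ hS hT hv).symm
      · intro h
        have hS : e ∉ S := fun hS =>
          SimpleGraph.notMem_of_mem_oddParts hKo h (inr_mem_barrier.2 hS)
        obtain ⟨z, hz, hKz, -⟩ := id hKo
        have hr : (H.matchingGadget.avoiding (H.barrier S T)).Reachable (.inr (e, i))
            (.inl (v₀, e₀, false)) := by
          rw [hKz] at h
          have hv₀' : Sum.inl (v₀, e₀, false) ∈ K := hv₀
          rw [hKz] at hv₀'
          exact (SimpleGraph.Reachable.symm h).trans hv₀'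
        obtain ⟨p⟩ := hr
        cases p with
        | cons h' p =>
          obtain ⟨v, hv, rfl⟩ := matchingGadget_adj_inr.1 h'.1
          have hT : e ∉ T := fun hT => h'.2.2 ⟨rfl, hT, hv⟩
          exact ⟨Finset.mem_univ _, hS, hT, v, hv,
            mem_trace.2 (SimpleGraph.mem_of_mem_oddParts hKo h (reachable_inr e₀ hS hT hv))⟩
  have hdisj : Disjoint K.toFinset D := Finset.disjoint_left.2 fun x hxK hxD =>
    SimpleGraph.notMem_of_mem_oddParts hKo (Set.mem_toFinset.1 hxK) (hDu hxD)
  rw [hZKD, Finset.card_union_of_disjoint hdisj, ← Set.ncard_eq_toFinset_card', hD] at hZ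
  grind

/-- By parity, failure leaves one T-incidence and no S-incidence. Every other edge meeting the trace
then lies inside it, so the edge of that incidence is a cut edge. -/
lemma three_le_of_forall_not_isCutEdge {k : ℕ} (hk : H.IsUniform k) (hk2 : 2 ≤ k)
    (hcut : ∀ e, ¬ H.IsCutEdge e) {S T : Finset E} {e₀ : E} {K : Set (V × E × Bool ⊕ E × Bool)}
    (hK : K ∈ H.largeParts S T e₀) :
    3 ≤ ((H.incidences T).filter fun p => p.1 ∈ trace e₀ K).card +
      2 * ((H.incidences S).filter fun p => p.1 ∈ trace e₀ K).card := by
  have hodd := odd_card_incidences_trace hK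
  by_contra! hlt
  have hT : ((H.incidences T).filter fun p => p.1 ∈ trace e₀ K).card = 1 := by grind
  have hS : ((H.incidences S).filter fun p => p.1 ∈ trace e₀ K).card = 0 := by omega
  obtain ⟨⟨v, e⟩, hve⟩ := Finset.card_eq_one.1 hT
  rw [Finset.card_eq_zero] at hS
  have hT' {w : V} {f : E} (hf : f ∈ T) (hw : w ∈ H.edge f) (hwK : w ∈ trace e₀ K) :
      w = v ∧ f = e := by
    have : (w, f) ∈ ((H.incidences T).filter fun p => p.1 ∈ trace e₀ K) :=
      Finset.mem_filter.2 ⟨mem_incidences.2 ⟨hf, hw⟩, hwK⟩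
    rw [hve] at this
    simpa using this
  have hS' {w : V} {f : E} (hw : w ∈ H.edge f) (hwK : w ∈ trace e₀ K) : f ∉ S := fun hf => by
    have : (w, f) ∈ ((H.incidences S).filter fun p => p.1 ∈ trace e₀ K) :=
      Finset.mem_filter.2 ⟨mem_incidences.2 ⟨hf, hw⟩, hwK⟩
    rw [hS] at this
    simp at this
  have hmem : (v, e) ∈ ((H.incidences T).filter fun p => p.1 ∈ trace e₀ K) := by simp [hve]
  obtain ⟨h1, hvK⟩ := Finset.mem_filter.1 hmem
  obtain ⟨heT, hv⟩ := mem_incidences.1 h1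
  simp only at heT hv hvK
  obtain ⟨w, hw, hwv⟩ : ∃ w ∈ H.edge e, w ≠ v :=
    Finset.exists_mem_ne (by rw [hk e]; omega) v
  refine hcut e (isCutEdge_of_closed (trace e₀ K) hv hw hvK
    (fun hwK => hwv (hT' heT hw hwK).1) fun f hfe x hx y hy hxK => ?_)
  exact mem_trace_of_mem_edge (mem_largeParts.1 hK).1 (hS' hx hxK)
    (fun hfT => hfe (hT' hfT hx hxK).2) hx hy hxK

lemma reachable_of_reflTransGen {S T : Finset E} {r : ℕ} {e₀ : E} {v w : V}
    (h : Relation.ReflTransGen ((H.loopedIncidenceGraph r).deleteVerts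
      (Sum.inr '' ((S ∪ T : Finset E) : Set E))).Adj (.inl v) (.inl w)) :
    (H.matchingGadget.avoiding (H.barrier S T)).Reachable
      (.inl (v, e₀, false)) (.inl (w, e₀, false)) := by
  let f : V ⊕ E → V × E × Bool ⊕ E × Bool :=
    Sum.elim (fun v => .inl (v, e₀, false)) (fun e => .inr (e, false))
  suffices ∀ z, Relation.ReflTransGen ((H.loopedIncidenceGraph r).deleteVerts
      (Sum.inr '' ((S ∪ T : Finset E) : Set E))).Adj (.inl v) z →
      (H.matchingGadget.avoiding (H.barrier S T)).Reachable (f (.inl v)) (f z) from this _ h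
  intro z hz
  induction hz with
  | refl => exact .refl _
  | @tail a b _ hab ih =>
    refine ih.trans ?_
    obtain ⟨e, he⟩ := hab
    rw [Graph.deleteVerts_isLink] at he
    obtain ⟨hlink, ha, hb⟩ := he
    have hnot {e : E} (h : (Sum.inr e : V ⊕ E) ∉ Sum.inr '' ((S ∪ T : Finset E) : Set E)) :
        e ∉ S ∧ e ∉ T := by
      constructor <;> intro he <;> exact h ⟨e, by simp [he], rfl⟩
    rcases e with s | ⟨x, i⟩
    · have hadj := hlink.1
      rcases a with a | a <;> rcases b with b | b
      · exact hadj.elim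
      · exact (reachable_inr e₀ (hnot hb).1 (hnot hb).2 hadj).symm
      · exact reachable_inr e₀ (hnot ha).1 (hnot ha).2 hadj
      · exact hadj.elim
    · obtain ⟨rfl, rfl⟩ := hlink
      exact .refl _

lemma card_largeParts_le_numComponents [Nonempty V] (S T : Finset E) (r : ℕ) (e₀ : E) :
    (H.largeParts S T e₀).card ≤ ((H.loopedIncidenceGraph r).deleteVerts
      (Sum.inr '' ((S ∪ T : Finset E) : Set E))).numComponents := by
  have hex (K : Set (V × E × Bool ⊕ E × Bool)) (hK : K ∈ H.largeParts S T e₀) :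
      ∃ v, v ∈ trace e₀ K := (mem_largeParts.1 hK).2
  choose! v hv using hex
  rw [← Set.ncard_coe_finset, Graph.numComponents]
  refine Set.ncard_le_ncard_of_injOn (fun K => {y | Relation.ReflTransGen
    ((H.loopedIncidenceGraph r).deleteVerts
      (Sum.inr '' ((S ∪ T : Finset E) : Set E))).Adj (.inl (v K)) y}) ?_ ?_ (Set.toFinite _)
  · intro K _
    refine ⟨.inl (v K), ?_, rfl⟩
    rw [Graph.vertexSet_deleteVerts]
    exact ⟨Set.mem_univ _, by simp⟩
  · intro K hK L hL hKL
    have hmem : Sum.inl (v L) ∈ {y | Relation.ReflTransGen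
        ((H.loopedIncidenceGraph r).deleteVerts
          (Sum.inr '' ((S ∪ T : Finset E) : Set E))).Adj (.inl (v K)) y} := by
      simp only at hKL
      rw [hKL]
      exact .refl
    have hr := reachable_of_reflTransGen (e₀ := e₀) hmem
    have hKo := (mem_largeParts.1 hK).1
    exact SimpleGraph.eq_of_mem_oddParts hKo (mem_largeParts.1 hL).1
      (SimpleGraph.mem_of_mem_oddParts hKo (hv K hK) hr) (hv L hL)

end Barrier

/-! ### The numerical inequality and the conclusion -/

lemma add_two_mul_le_of_bounds {k s t q c : ℕ} (hk : 3 ≤ k) (h1 : q ≤ k * t)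
    (h2 : 3 * q ≤ k * t + 2 * (k * s)) (h3 : q ≤ c)
    (h4 : 2 ≤ s + t → 2 * ((c + 3) / k) ≤ s + t) : q + 2 * t ≤ 2 * s + k * t := by
  -- For k = 3, `h2` alone gives q ≤ 2s + t.
  obtain rfl | hk4 := hk.eq_or_lt
  · omega
  -- If t ≤ s, then `h1` and 2t ≤ 2s suffice.
  obtain hts | hst := le_or_gt t s
  · omega
  obtain hst2 | hst2 := lt_or_ge (s + t) 2
  · obtain ⟨rfl, rfl⟩ : s = 0 ∧ t = 1 := by omega
    omega
  -- With a the quotient, this says c ≤ k(a + 1) - 4, to be combined with 2a ≤ s + t.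
  have h5 : c + 3 < k * ((c + 3) / k + 1) := Nat.lt_mul_div_succ _ (by omega)
  have h6 := h4 hst2
  obtain ⟨d, rfl⟩ : ∃ d, t = s + d := ⟨t - s, by omega⟩
  obtain ⟨l, rfl⟩ : ∃ l, k = l + 4 := ⟨k - 4, by omega⟩
  generalize (c + 3) / (l + 4) = a at *
  have h7 : (l + 4) * (2 * a) ≤ (l + 4) * (s + (s + d)) := Nat.mul_le_mul_left _ h6
  -- For t = s + 1 the sum s + t is odd, so integrality improves the bound to a ≤ s; for t ≥ s + 2
  -- no rounding is needed.
  obtain rfl | hd := (show 1 ≤ d by omega).eq_or_lt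
  · have h8 : a ≤ s := by omega
    nlinarith
  · nlinarith

end MultiHypergraph

theorem proposition4 {V E : Type*} [Fintype V] [Nonempty V] [Fintype E]
    (k : ℕ) (hk : 3 ≤ k) (H : MultiHypergraph V E) (huniform : H.IsUniform k)
    (n m : ℕ) (hn : H.order = n) (hm : H.size = m)
    (hcut : ∀ e : E, ¬ H.IsCutEdge e)
    (hX : ∀ X : Finset E, 2 ≤ X.card →
      2 * ((((H.loopedIncidenceGraph (2 * (m + n) ^ 2)).deleteVerts
        (Sum.inr '' (X : Set E))).numComponents + 3) / k) ≤ X.card) :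
    H.IsQuasiEulerian := by
  classical
  obtain hE | ⟨⟨e₀⟩⟩ := isEmpty_or_nonempty E
  · exact Or.inl hE
  by_cases hM : ∃ M : H.matchingGadget.Subgraph, M.IsPerfectMatching
  · obtain ⟨M, hM⟩ := hM
    exact MultiHypergraph.isQuasiEulerian_of_isPerfectMatching hM
  push Not at hM
  obtain ⟨S', T', hdisj, hlt⟩ := H.exists_barrier hM
  obtain ⟨S, rfl⟩ : ∃ S : Finset E, S' = S := ⟨S'.toFinset, by simp⟩
  obtain ⟨T, rfl⟩ : ∃ T : Finset E, T' = T := ⟨T'.toFinset, by simp⟩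
  have hST : (S ∪ T).card = S.card + T.card :=
    Finset.card_union_of_disjoint (by exact_mod_cast hdisj)
  have hbarrier := MultiHypergraph.le_ncard_barrier huniform S T
  have hparts := MultiHypergraph.ncard_oddParts_barrier_le huniform (by omega) S T e₀
  have hsumT := MultiHypergraph.sum_card_incidences_trace_le huniform S T e₀ T
  have hsumS := MultiHypergraph.sum_card_incidences_trace_le huniform S T e₀ S
  have h1 : (H.largeParts S T e₀).card ≤ k * T.card := by
    refine le_trans ?_ hsumT
    rw [Finset.card_eq_sum_ones]
    exact Finset.sum_le_sum fun K hK => (MultiHypergraph.odd_card_incidences_trace hK).pos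
  have h2 : 3 * (H.largeParts S T e₀).card ≤ k * T.card + 2 * (k * S.card) := by
    have := Finset.sum_le_sum fun K (hK : K ∈ H.largeParts S T e₀) =>
      MultiHypergraph.three_le_of_forall_not_isCutEdge huniform (by omega) hcut hK
    rw [Finset.sum_const, smul_eq_mul, Finset.sum_add_distrib, ← Finset.mul_sum] at this
    omega
  have h3 := MultiHypergraph.card_largeParts_le_numComponents (H := H) S T (2 * (m + n) ^ 2) e₀
  have h4 := hX (S ∪ T)
  rw [hST] at h4
  have := MultiHypergraph.add_two_mul_le_of_bounds hk h1 h2 h3 h4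
  omega
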